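/- Work over $\mathbb F_2$. For a matrix $M\in\mathbb F_2^{m\times n}$ with rows $M_1,\dots,M_m$, a *cell-probe data structure for $M$ with space $s$ and $t$ probes* consists of an arbitrary (not necessarily linear) preprocessing map $\mathbb F_2^n\to\{0,1\}^s$, $X\mapsto U(X)$, and, for every $i\in[m]$, a deterministic decision tree of depth at most $t$ which adaptively probes the $s$ one-bit cells of $U(X)$ and outputs $\langle M_i,X\rangle$ for every $X\in\mathbb F_2^n$. All logarithms are to base $2$. **Theorem.** (1) There is an absolute constant $C$ such that the following holds for all integers $n\ge 0$ and $t,s,m\ge 100$ and every collection $\mathcal S\subseteq\mathbb F_2^n$. If $$m\ \ge\ C\cdot s\cdot 2^{3t}\qquad\text{and}\qquad \log|\mathcal S|\ \ge\ 40\cdot t\cdot\log s,$$ then there are $M_1,\dots,M_m\in\mathcal S$ (pairwise distinct if $m\le|\mathcal S|$) such that the matrix with rows $M_1,\dots,M_m$ has no cell-probe data structure with space $s$ and $t$ probes. (2) There is an absolute constant $c>0$ such that for every $\delta>0$ there is $K$ such that for all integers $n,m\ge 0$ and $s\ge K$ the following holds: with probability at least $1-\delta$ over a uniformly random $M\in\mathbb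 F_2^{m\times n}$, every cell-probe data structure for $M$ with space $s$ and $t$ probes satisfies $$t\ \ge\ c\cdot\min\Big\{\log\frac ms,\ \frac n{\log s}\Big\}.$$ (For $m\le s$ the bound is trivial.) -/

import Mathlib

/-- An adaptive query algorithm on a memory of `s` one-bit cells, as a decision tree: it either
stops with an answer in `𝔽₂`, or probes a cell and continues according to the bit it reads.
Computation between probes is free. -/
inductive ProbeTree (s : ℕ) : Type
  | answer (b : ZMod 2) : ProbeTree s
  | probe (cell : Fin s) (next : Bool → ProbeTree s) : ProbeTree s

namespace ProbeTree

/-- The worst-case number of probes (the depth of the decision tree). -/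
def depth {s : ℕ} : ProbeTree s → ℕ
  | answer _ => 0
  | probe _ next => max (depth (next false)) (depth (next true)) + 1

/-- The answer returned when the memory content is `u`. -/
def eval {s : ℕ} (u : Fin s → Bool) : ProbeTree s → ZMod 2
  | answer b => b
  | probe cell next => eval u (next (u cell))

end ProbeTree

/-- The linear operator `x ↦ M x` over `𝔽₂` has a static cell-probe data structure with `s` one-bit
cells and at most `t` adaptive probes per query: an arbitrary preprocessing map writes the `s` bits
from `x`, and for each row `i` a decision tree of depth at most `t` (which may depend on `M` and
`i`, but not on `x`) always outputs `⟨M i, x⟩`. -/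
def HasCellProbeDS {m n : ℕ} (M : Matrix (Fin m) (Fin n) (ZMod 2)) (s t : ℕ) : Prop :=
  ∃ (pre : (Fin n → ZMod 2) → Fin s → Bool) (alg : Fin m → ProbeTree s),
    ∀ i, (alg i).depth ≤ t ∧ ∀ x, (alg i).eval (pre x) = M i ⬝ᵥ x

/-! ### Characters and orthogonality -/

/-- The additive character `z ↦ (-1)^z` of `𝔽₂`. -/
noncomputable def signChar (z : ZMod 2) : ℝ := if z = 0 then 1 else -1

lemma signChar_add (a b : ZMod 2) : signChar (a + b) = signChar a * signChar b := by
  revert a b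
  have h : ∀ a : ZMod 2, a = 0 ∨ a = 1 := by decide
  intro a b
  rcases h a with rfl | rfl <;> rcases h b with rfl | rfl <;>
    simp [signChar, show (1 : ZMod 2) + 1 = 0 from rfl]

lemma signChar_mul_self (a : ZMod 2) : signChar a * signChar a = 1 := by
  unfold signChar; split_ifs <;> norm_num

lemma abs_signChar (a : ZMod 2) : |signChar a| = 1 := by
  unfold signChar; split_ifs <;> norm_num

/-- Translating `x` by a basis vector on which `v` is nonzero flips every sign. -/
lemma sum_signChar_dotProduct {n : ℕ} {v : Fin n → ZMod 2} (hv : v ≠ 0) :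
    ∑ x : Fin n → ZMod 2, signChar (v ⬝ᵥ x) = 0 := by
  obtain ⟨i, hi⟩ := Function.ne_iff.mp hv
  have hi1 : v i = 1 := by
    have h : ∀ a : ZMod 2, a ≠ 0 → a = 1 := by decide
    exact h _ hi
  have h := Equiv.sum_comp (Equiv.addRight (Pi.single i (1 : ZMod 2)))
    (fun x : Fin n → ZMod 2 => signChar (v ⬝ᵥ x))
  have h1 : signChar 1 = -1 := by simp [signChar]
  simp only [Equiv.coe_addRight, dotProduct_add, dotProduct_single, hi1, mul_one, signChar_add,
    h1, mul_neg, Finset.sum_neg_distrib] at h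
  linarith

lemma sum_signChar_mul_signChar {n : ℕ} (v w : Fin n → ZMod 2) :
    ∑ x : Fin n → ZMod 2, signChar (v ⬝ᵥ x) * signChar (w ⬝ᵥ x) =
      if v = w then (Fintype.card (Fin n → ZMod 2) : ℝ) else 0 := by
  split_ifs with h
  · subst h
    simp [signChar_mul_self]
  · simp_rw [← signChar_add, ← add_dotProduct]
    refine sum_signChar_dotProduct fun h0 => h ?_
    rw [add_eq_zero_iff_eq_neg] at h0
    rw [h0]
    ext i
    simp [ZMod.neg_eq_self_mod_two]

/-! ### Decision trees and cell parities -/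

/-- The sign of a memory bit. -/
noncomputable def bitSign (b : Bool) : ℝ := if b then -1 else 1

/-- The parity, as a sign, of the cells listed by `A` (with repetitions). -/
noncomputable def cellParity {s t : ℕ} (A : Fin t → Option (Fin s)) (u : Fin s → Bool) : ℝ :=
  ∏ i, (A i).elim 1 fun c => bitSign (u c)

lemma cellParity_cons {s t : ℕ} (a : Option (Fin s)) (A : Fin t → Option (Fin s))
    (u : Fin s → Bool) :
    cellParity (Fin.cons a A : Fin (t + 1) → Option (Fin s)) u =
      (a.elim 1 fun c => bitSign (u c)) * cellParity A u := by
  simp [cellParity, Fin.prod_univ_succ]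

lemma abs_cellParity {s t : ℕ} (A : Fin t → Option (Fin s)) (u : Fin s → Bool) :
    |cellParity A u| = 1 := by
  rw [cellParity, Finset.abs_prod]
  refine Finset.prod_eq_one fun i _ => ?_
  cases A i with
  | none => simp
  | some c => simp only [Option.elim, bitSign]; split_ifs <;> norm_num

namespace ProbeTree

/-- A shallow decision tree correlates with a weight at most `2 ^ t` times as much as the
parities of at most `t` cells do. -/
lemma abs_sum_signChar_eval_le {s : ℕ} {J : Type*} [Fintype J] (u : J → Fin s → Bool)
    (T : ProbeTree s) (t : ℕ) (hT : T.depth ≤ t) (f : J → ℝ) (B : ℝ)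
    (hB : ∀ A : Fin t → Option (Fin s), |∑ j, f j * cellParity A (u j)| ≤ B) :
    |∑ j, f j * signChar (T.eval (u j))| ≤ 2 ^ t * B := by
  induction T generalizing t f B with
  | answer b =>
    have h := hB fun _ => none
    simp only [cellParity, Option.elim, Finset.prod_const_one, mul_one] at h
    simp only [eval]
    rw [← Finset.sum_mul, abs_mul, abs_signChar, mul_one]
    have h1 : (1 : ℝ) ≤ 2 ^ t := one_le_pow₀ (by norm_num)
    nlinarith [abs_nonneg (∑ j, f j)]
  | probe c next ih =>
    obtain _ | t := t
    · simp [depth] at hT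
    simp only [depth, add_le_add_iff_right, max_le_iff] at hT
    have key : ∀ (b : Bool),
        |∑ j, f j * signChar ((next b).eval (u j))| ≤ 2 ^ t * B ∧
        |∑ j, f j * bitSign (u j c) * signChar ((next b).eval (u j))| ≤ 2 ^ t * B := by
      intro b
      have hd : (next b).depth ≤ t := by cases b <;> simp [hT]
      refine ⟨ih b t hd f B fun A => ?_, ih b t hd _ B fun A => ?_⟩
      · simpa [cellParity_cons] using hB (Fin.cons none A)
      · simpa [cellParity_cons, mul_assoc] using hB (Fin.cons (some c) A)
    -- The weights `(1 ± bitSign) / 2` select the branch taken. Half of four terms, each at most `2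
    -- ^ t * B`, gives `2 ^ (t + 1) * B`.
    have hsplit : ∑ j, f j * signChar ((probe c next).eval (u j)) =
        (1 / 2) * (∑ j, f j * signChar ((next false).eval (u j)) +
          ∑ j, f j * bitSign (u j c) * signChar ((next false).eval (u j)) +
          ∑ j, f j * signChar ((next true).eval (u j)) -
          ∑ j, f j * bitSign (u j c) * signChar ((next true).eval (u j))) := by
      rw [← Finset.sum_add_distrib, ← Finset.sum_add_distrib, ← Finset.sum_sub_distrib,
        Finset.mul_sum]
      refine Finset.sum_congr rfl fun j _ => ?_
      simp only [eval]
      cases u j c <;> simp only [bitSign] <;> norm_num <;> ring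
    obtain ⟨h1, h2⟩ := key false
    obtain ⟨h3, h4⟩ := key true
    rw [hsplit, pow_succ]
    rw [abs_le] at *
    constructor <;> linarith [h1.1, h1.2]

end ProbeTree

/-! ### List decoding at random points -/

/-- The normalised absolute character sum over a finite set of vectors. -/
noncomputable def charMean {n : ℕ} (L : Finset (Fin n → ZMod 2)) (x : Fin n → ZMod 2) : ℝ :=
  |∑ v ∈ L, signChar (v ⬝ᵥ x)| / L.card

lemma charMean_nonneg {n : ℕ} (L : Finset (Fin n → ZMod 2)) (x : Fin n → ZMod 2) :
    0 ≤ charMean L x := by unfold charMean; positivity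

lemma charMean_le_one {n : ℕ} (L : Finset (Fin n → ZMod 2)) (x : Fin n → ZMod 2) :
    charMean L x ≤ 1 := by
  refine div_le_one_of_le₀ ((Finset.abs_sum_le_sum_abs _ _).trans ?_) (by positivity)
  simp [abs_signChar]

lemma sum_sq_sum_signChar {n : ℕ} (L : Finset (Fin n → ZMod 2)) :
    ∑ x, (∑ v ∈ L, signChar (v ⬝ᵥ x)) ^ 2 =
      (L.card : ℝ) * Fintype.card (Fin n → ZMod 2) := by
  simp_rw [sq, Finset.sum_mul_sum]
  rw [Finset.sum_comm]
  simp_rw [Finset.sum_comm (s := Finset.univ), sum_signChar_mul_signChar]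
  simp

/-- Orthogonality gives the second moment; Cauchy–Schwarz passes to the first. -/
lemma sum_charMean_le {n r : ℕ} (L : Finset (Fin n → ZMod 2)) (hL : L.card = r ^ 2) (hr : 0 < r) :
    ∑ x, charMean L x ≤ (Fintype.card (Fin n → ZMod 2) : ℝ) / r := by
  have hr' : (0 : ℝ) < r := by exact_mod_cast hr
  have h := sq_sum_le_card_mul_sum_sq (s := Finset.univ) (f := charMean L)
  have h2 : ∑ x, charMean L x ^ 2 = (Fintype.card (Fin n → ZMod 2) : ℝ) / (r : ℝ) ^ 2 := by
    simp_rw [charMean, div_pow, sq_abs]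
    rw [← Finset.sum_div, sum_sq_sum_signChar, hL]
    push_cast
    field_simp
  rw [h2] at h
  refine abs_le_of_sq_le_sq' ?_ (by positivity) |>.2
  refine h.trans (le_of_eq ?_)
  rw [Finset.card_univ]
  field_simp

/-- Exponential moment bound and Markov's inequality for `charMean`. -/
lemma card_charMean_large_le {n k a e : ℕ} (L : Finset (Fin n → ZMod 2))
    (hL : L.card = (2 ^ (a + 2)) ^ 2) (hk : k = 2 ^ (a + 1) * e) :
    ((Finset.univ.filter fun x : Fin k → Fin n → ZMod 2 =>
        (k : ℝ) / 2 ^ a ≤ ∑ j, charMean L (x j)).card : ℝ) * 2 ^ e ≤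
      (Fintype.card (Fin n → ZMod 2) : ℝ) ^ k := by
  set D : ℝ := (Fintype.card (Fin n → ZMod 2) : ℝ) with hD
  have hke : (k : ℝ) / 2 ^ a = 2 * e := by
    rw [hk]; push_cast; field_simp; ring
  have hmom : ∑ x, (2 : ℝ) ^ charMean L x ≤ D * (1 + 1 / 2 ^ (a + 2)) := by
    have h1 : ∀ x, (2 : ℝ) ^ charMean L x ≤ 1 + charMean L x := fun x => by
      have := rpow_one_add_le_one_add_mul_self (s := 1) (by norm_num)
        (charMean_nonneg L x) (charMean_le_one L x)
      norm_num at this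
      exact this
    refine (Finset.sum_le_sum fun x _ => h1 x).trans ?_
    rw [Finset.sum_add_distrib]
    have h2 := sum_charMean_le L hL (by positivity)
    push_cast at h2
    simp only [Finset.sum_const, Finset.card_univ, nsmul_eq_mul, mul_one]
    calc _ ≤ D + D / 2 ^ (a + 2) := by gcongr
      _ = _ := by ring
  have hpow : (1 + 1 / 2 ^ (a + 2) : ℝ) ^ k ≤ 2 ^ e := by
    rw [hk, pow_mul]
    refine pow_le_pow_left₀ (by positivity) ?_ e
    have h1 : (1 + 1 / 2 ^ (a + 2) : ℝ) ≤ Real.exp (1 / 2 ^ (a + 2)) := by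
      rw [add_comm]; exact Real.add_one_le_exp _
    calc (1 + 1 / 2 ^ (a + 2) : ℝ) ^ 2 ^ (a + 1)
        ≤ Real.exp (1 / 2 ^ (a + 2)) ^ 2 ^ (a + 1) := pow_le_pow_left₀ (by positivity) h1 _
      _ = Real.exp (1 / 2) := by
          rw [← Real.exp_nat_mul]; congr 1; push_cast; rw [pow_succ, pow_succ, pow_succ]; field_simp
      _ ≤ 2 := by
          have h3 := Real.exp_one_lt_d9
          have h4 : Real.exp (1 / 2) ^ 2 = Real.exp 1 := by
            rw [← Real.exp_nat_mul]; norm_num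
          nlinarith [Real.exp_pos (1 / 2)]
  have hsum : ∑ x : Fin k → Fin n → ZMod 2, (2 : ℝ) ^ ∑ j, charMean L (x j) ≤ D ^ k * 2 ^ e := by
    simp_rw [Real.rpow_sum_of_pos (show (0 : ℝ) < 2 by norm_num)]
    rw [← Fintype.sum_pow (fun x => (2 : ℝ) ^ charMean L x)]
    calc _ ≤ (D * (1 + 1 / 2 ^ (a + 2))) ^ k :=
          pow_le_pow_left₀ (Finset.sum_nonneg fun _ _ => by positivity) hmom k
      _ ≤ _ := by rw [mul_pow]; gcongr
  -- The threshold `k / 2 ^ a` equals `2 * e`, while the moment costs only `2 ^ e`, so a factor `2 ^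
  -- e` is gained.
  have hmarkov : ((Finset.univ.filter fun x : Fin k → Fin n → ZMod 2 =>
        (k : ℝ) / 2 ^ a ≤ ∑ j, charMean L (x j)).card : ℝ) * (2 ^ e * 2 ^ e) ≤
      ∑ x : Fin k → Fin n → ZMod 2, (2 : ℝ) ^ ∑ j, charMean L (x j) := by
    rw [← nsmul_eq_mul]
    refine (Finset.card_nsmul_le_sum _ _ _ fun x hx => ?_).trans
      (Finset.sum_le_sum_of_subset_of_nonneg (Finset.filter_subset _ _)
        fun _ _ _ => by positivity)
    rw [Finset.mem_filter, hke] at hx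
    calc (2 : ℝ) ^ e * 2 ^ e = (2 : ℝ) ^ (2 * e : ℝ) := by
          rw [← pow_add, ← two_mul]; exact_mod_cast (Real.rpow_natCast 2 (2 * e)).symm
      _ ≤ _ := Real.rpow_le_rpow_of_exponent_le (by norm_num) hx.2
  have hpos : (0 : ℝ) < 2 ^ e := by positivity
  nlinarith [hmarkov.trans hsum]

/-- Few random points already give every family of `2 ^ (2 * a + 4)` characters small
mean. -/
lemma exists_points_charMean_small {n a q k : ℕ} (S : Finset (Fin n → ZMod 2)) (hq : 0 < q)
    (hS : S.card ≤ 2 ^ q) (hk : k = 2 ^ (3 * a + 6) * q) :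
    ∃ x : Fin k → Fin n → ZMod 2,
      ∀ L ⊆ S, L.card = 2 ^ (2 * a + 4) →
        ∑ j, charMean L (x j) < (k : ℝ) / 2 ^ a := by
  set l := 2 ^ (2 * a + 4) with hl
  by_contra! hcon
  have hcover : (Finset.univ : Finset (Fin k → Fin n → ZMod 2)) ⊆
      (S.powersetCard l).biUnion fun L => Finset.univ.filter fun x : Fin k → Fin n → ZMod 2 =>
        (k : ℝ) / 2 ^ a ≤ ∑ j, charMean L (x j) := by
    intro x _
    obtain ⟨L, hLS, hLc, hx⟩ := hcon x
    simp only [Finset.mem_biUnion, Finset.mem_powersetCard, Finset.mem_filter, Finset.mem_univ,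
      true_and]
    exact ⟨L, ⟨hLS, hLc⟩, hx⟩
  set D : ℝ := (Fintype.card (Fin n → ZMod 2) : ℝ) with hD
  have hDpos : 0 < D ^ k := by
    have : 0 < Fintype.card (Fin n → ZMod 2) := Fintype.card_pos
    positivity
  -- Here `k = 2 ^ (a + 1) * (2 * l * q)`: the failure probability `2 ^ (-2 * l * q)` beats the
  -- union bound over at most `2 ^ (q * l)` sets.
  have hbound : ∀ L ∈ S.powersetCard l,
      ((Finset.univ.filter fun x : Fin k → Fin n → ZMod 2 =>
        (k : ℝ) / 2 ^ a ≤ ∑ j, charMean L (x j)).card : ℝ) ≤ D ^ k / 2 ^ (2 * l * q) := by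
    intro L hL
    rw [le_div_iff₀ (by positivity)]
    refine card_charMean_large_le L ?_ ?_
    · rw [(Finset.mem_powersetCard.mp hL).2, hl, ← pow_mul]; congr 1; ring
    · rw [hk, hl]; ring
  have h1 : D ^ k ≤ (2 ^ q) ^ l * (D ^ k / 2 ^ (2 * l * q)) := by
    calc D ^ k = ((Finset.univ : Finset (Fin k → Fin n → ZMod 2)).card : ℝ) := by
          simp [hD]
      _ ≤ ∑ L ∈ S.powersetCard l, ((Finset.univ.filter fun x : Fin k → Fin n → ZMod 2 =>
            (k : ℝ) / 2 ^ a ≤ ∑ j, charMean L (x j)).card : ℝ) := by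
          rw [← Nat.cast_sum, Nat.cast_le]
          exact (Finset.card_le_card hcover).trans Finset.card_biUnion_le
      _ ≤ ∑ L ∈ S.powersetCard l, D ^ k / 2 ^ (2 * l * q) := Finset.sum_le_sum hbound
      _ = (S.card.choose l : ℝ) * (D ^ k / 2 ^ (2 * l * q)) := by simp
      _ ≤ _ := by
          gcongr
          exact_mod_cast (Nat.choose_le_pow S.card l).trans (Nat.pow_le_pow_left hS l)
  have hlt : ((2 : ℝ) ^ q) ^ l < 2 ^ (2 * l * q) := by
    rw [← pow_mul]
    refine pow_lt_pow_right₀ (by norm_num) ?_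
    have : 0 < l * q := by positivity
    nlinarith
  rw [← mul_div_assoc, le_div_iff₀ (by positivity)] at h1
  nlinarith

/-- The list-decoding bound: few vectors of `S` correlate with a given word on these points. -/
lemma exists_points_card_correlated_lt {n a q k : ℕ} (S : Finset (Fin n → ZMod 2)) (hq : 0 < q)
    (hS : S.card ≤ 2 ^ q) (hk : k = 2 ^ (3 * a + 6) * q) :
    ∃ x : Fin k → Fin n → ZMod 2,
      ∀ y : Fin k → ℝ, (∀ j, |y j| ≤ 1) →
        (S.filter fun v => (k : ℝ) / 2 ^ a ≤
          ∑ j, signChar (v ⬝ᵥ x j) * y j).card < 2 ^ (2 * a + 4) := by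
  obtain ⟨x, hx⟩ := exists_points_charMean_small (a := a) S hq hS hk
  refine ⟨x, fun y hy => ?_⟩
  by_contra! hcon
  obtain ⟨L, hLsub, hLc⟩ := Finset.exists_subset_card_eq hcon
  refine absurd (hx L (hLsub.trans (Finset.filter_subset _ _)) hLc) (not_lt.mpr ?_)
  have hLpos : (0 : ℝ) < L.card := by rw [hLc]; positivity
  simp_rw [charMean]
  rw [← Finset.sum_div, le_div_iff₀ hLpos, mul_comm, ← nsmul_eq_mul]
  calc _ ≤ ∑ v ∈ L, ∑ j, signChar (v ⬝ᵥ x j) * y j :=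
        Finset.card_nsmul_le_sum _ _ _ fun v hv => (Finset.mem_filter.mp (hLsub hv)).2
    _ = ∑ j, (∑ v ∈ L, signChar (v ⬝ᵥ x j)) * y j := by
        rw [Finset.sum_comm]; simp_rw [Finset.sum_mul]
    _ ≤ _ := Finset.sum_le_sum fun j _ => by
        refine (le_abs_self _).trans ?_
        rw [abs_mul]
        exact mul_le_of_le_one_right (abs_nonneg _) (hy j)

/-! ### Counting easy matrices -/

/-- The signed cell parities `u ↦ ± cellParity A u`. -/
noncomputable def signedParity {s t : ℕ} (p : Bool × (Fin t → Option (Fin s)))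
    (u : Fin s → Bool) : ℝ :=
  bitSign p.1 * cellParity p.2 u

lemma abs_signedParity {s t : ℕ} (p : Bool × (Fin t → Option (Fin s))) (u : Fin s → Bool) :
    |signedParity p u| = 1 := by
  rw [signedParity, abs_mul, abs_cellParity, mul_one, bitSign]
  split_ifs <;> norm_num

lemma ProbeTree.exists_signedParity {s t k : ℕ} (T : ProbeTree s) (hT : T.depth ≤ t)
    (u : Fin k → Fin s → Bool) (z : Fin k → ZMod 2) (hz : ∀ j, T.eval (u j) = z j) :
    ∃ p : Bool × (Fin t → Option (Fin s)),
      (k : ℝ) / 2 ^ t ≤ ∑ j, signChar (z j) * signedParity p (u j) := by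
  by_contra! hcon
  obtain ⟨A₀, -, hmax⟩ := Finset.exists_max_image (Finset.univ : Finset (Fin t → Option (Fin s)))
    (fun A => |∑ j, signChar (z j) * cellParity A (u j)|) Finset.univ_nonempty
  have h := ProbeTree.abs_sum_signChar_eval_le u T t hT (fun j => signChar (z j)) _
    fun A => hmax A (Finset.mem_univ A)
  simp only [hz, signChar_mul_self, Finset.sum_const, Finset.card_univ, Fintype.card_fin,
    nsmul_eq_mul, mul_one, Nat.abs_cast] at h
  have h1 := hcon (false, A₀)
  have h2 := hcon (true, A₀)
  simp only [signedParity, bitSign, Bool.false_eq_true, if_false, if_true, one_mul, neg_mul,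
    mul_neg, Finset.sum_neg_distrib] at h1 h2
  have h3 : |∑ j, signChar (z j) * cellParity A₀ (u j)| < (k : ℝ) / 2 ^ t := by
    rw [abs_lt]; constructor <;> linarith
  rw [lt_div_iff₀ (by positivity)] at h3
  linarith

open Classical in
/-- An upper bound for the number of matrices with rows in `S` that have a cell-probe data
structure. -/
lemma card_hasCellProbeDS_le {n m s t q : ℕ} (S : Finset (Fin n → ZMod 2)) (hq : 0 < q)
    (hS : S.card ≤ 2 ^ q) :
    ((Fintype.piFinset fun _ : Fin m => S).filter fun M =>
        HasCellProbeDS (Matrix.of M) s t).card ≤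
      (2 ^ s) ^ (2 ^ (3 * t + 6) * q) * (2 * (s + 1) ^ t * 2 ^ (2 * t + 4)) ^ m := by
  obtain ⟨k, hk⟩ : ∃ k, k = 2 ^ (3 * t + 6) * q := ⟨_, rfl⟩
  rw [← hk]
  obtain ⟨x, hx⟩ := exists_points_card_correlated_lt S hq hS hk
  -- The candidate rows depend only on the memory contents `V` at the chosen points.
  let G : (Fin k → Fin s → Bool) → Finset (Fin n → ZMod 2) := fun V =>
    (Finset.univ : Finset (Bool × (Fin t → Option (Fin s)))).biUnion fun p =>
      S.filter fun v => (k : ℝ) / 2 ^ t ≤ ∑ j, signChar (v ⬝ᵥ x j) * signedParity p (V j)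
  have hG : ∀ V, (G V).card ≤ 2 * (s + 1) ^ t * 2 ^ (2 * t + 4) := fun V => by
    refine (Finset.card_biUnion_le_card_mul _ _ (2 ^ (2 * t + 4)) fun p _ =>
      (hx _ fun j => (abs_signedParity p (V j)).le).le).trans_eq ?_
    simp
  have hsub : ((Fintype.piFinset fun _ : Fin m => S).filter fun M =>
        HasCellProbeDS (Matrix.of M) s t) ⊆
      (Finset.univ : Finset (Fin k → Fin s → Bool)).biUnion fun V =>
        Fintype.piFinset fun _ : Fin m => G V := by
    intro M hM
    obtain ⟨hMS, pre, alg, halg⟩ := Finset.mem_filter.mp hM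
    rw [Fintype.mem_piFinset] at hMS
    simp only [Finset.mem_biUnion, Finset.mem_univ, true_and, Fintype.mem_piFinset]
    refine ⟨fun j => pre (x j), fun i => ?_⟩
    obtain ⟨p, hp⟩ := (alg i).exists_signedParity (halg i).1 (fun j => pre (x j))
      (fun j => M i ⬝ᵥ x j) fun j => (halg i).2 (x j)
    exact Finset.mem_biUnion.mpr ⟨p, Finset.mem_univ p, Finset.mem_filter.mpr ⟨hMS i, hp⟩⟩
  refine (Finset.card_le_card hsub).trans ?_
  refine (Finset.card_biUnion_le_card_mul _ _ ((2 * (s + 1) ^ t * 2 ^ (2 * t + 4)) ^ m)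
    fun V _ => ?_).trans_eq ?_
  · rw [Fintype.card_piFinset_const]
    exact Nat.pow_le_pow_left (hG V) m
  · simp

open Classical in
/-- If `m` is large compared to `s * 2 ^ (3 * t)` and `S` is large compared to `s ^ t`, then few
matrices with rows in `S` have a cell-probe data structure. -/
lemma card_hasCellProbeDS_pow_four_le {n m s t : ℕ} (S : Finset (Fin n → ZMod 2))
    (ht : 1 ≤ t) (hs : 100 ≤ s) (hm : 1024 * (s * 2 ^ (3 * t)) ≤ m)
    (hS : s ^ (40 * t) ≤ S.card) :
    ((Fintype.piFinset fun _ : Fin m => S).filter fun M =>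
        HasCellProbeDS (Matrix.of M) s t).card ^ 4 ≤ S.card ^ m := by
  set N := S.card with hN
  have hN2 : 2 ≤ N := by
    calc 2 ≤ s ^ 1 := by rw [pow_one]; omega
      _ ≤ s ^ (40 * t) := Nat.pow_le_pow_right (by omega) (by omega)
      _ ≤ N := hS
  set q := Nat.clog 2 N with hq
  have hqpos : 0 < q := Nat.clog_pos (by norm_num) hN2
  have hNq : N ≤ 2 ^ q := Nat.le_pow_clog (by norm_num) N
  have hqN : 2 ^ q ≤ N ^ 2 := by
    have h := Nat.pow_pred_clog_lt_self (b := 2) (by norm_num) hN2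
    rw [← hq] at h
    obtain ⟨r, hr⟩ : ∃ r, q = r + 1 := ⟨q - 1, by omega⟩
    rw [hr] at h ⊢
    simp only [Nat.pred_eq_sub_one, Nat.add_sub_cancel] at h
    rw [pow_succ, sq]
    exact Nat.mul_le_mul h.le hN2
  have hbad := card_hasCellProbeDS_le (m := m) (s := s) (t := t) S hqpos hNq
  set b := ((Fintype.piFinset fun _ : Fin m => S).filter fun M =>
        HasCellProbeDS (Matrix.of M) s t).card
  -- The constant is `1024 = 2 ^ 6 * 8 * 2`; the last factor pays for `2 ^ q ≤ N ^ 2`.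
  have h1 : ((2 ^ s) ^ (2 ^ (3 * t + 6) * q)) ^ 8 ≤ N ^ m := by
    have h : (((2 ^ s) ^ (2 ^ (3 * t + 6) * q)) ^ 8) ^ 2 ≤ (N ^ m) ^ 2 := by
      calc _ = 2 ^ (1024 * (s * 2 ^ (3 * t)) * q) := by
            rw [← pow_mul, ← pow_mul, ← pow_mul]; congr 1; ring
        _ ≤ 2 ^ (q * m) := by
            refine Nat.pow_le_pow_right (by norm_num) ?_
            rw [mul_comm q]
            exact Nat.mul_le_mul_right q hm
        _ = (2 ^ q) ^ m := pow_mul _ _ _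
        _ ≤ (N ^ 2) ^ m := Nat.pow_le_pow_left hqN m
        _ = _ := by rw [← pow_mul, ← pow_mul, mul_comm]
    exact (Nat.pow_le_pow_iff_left (by norm_num)).mp h
  have h2 : (2 * (s + 1) ^ t * 2 ^ (2 * t + 4)) ^ 8 ≤ N := by
    have h : 2 * (s + 1) ^ t * 2 ^ (2 * t + 4) ≤ s ^ (5 * t) := by
      have ha : (s + 1) ^ t ≤ s ^ (2 * t) := by
        rw [pow_mul]; exact Nat.pow_le_pow_left (by nlinarith) t
      have hb : 2 * 2 ^ (2 * t + 4) ≤ s ^ (3 * t) := by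
        calc 2 * 2 ^ (2 * t + 4) = 2 ^ (2 * t + 5) := by ring
          _ ≤ 2 ^ (6 * (3 * t)) := Nat.pow_le_pow_right (by norm_num) (by omega)
          _ = 64 ^ (3 * t) := by rw [pow_mul]; norm_num
          _ ≤ _ := Nat.pow_le_pow_left (by omega) _
      calc 2 * (s + 1) ^ t * 2 ^ (2 * t + 4) = (s + 1) ^ t * (2 * 2 ^ (2 * t + 4)) := by ring
        _ ≤ s ^ (2 * t) * s ^ (3 * t) := Nat.mul_le_mul ha hb
        _ = _ := by rw [← pow_add]; congr 1; ring
    calc _ ≤ (s ^ (5 * t)) ^ 8 := Nat.pow_le_pow_left h 8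
      _ = s ^ (40 * t) := by rw [← pow_mul]; congr 1; ring
      _ ≤ N := hS
  have h3 : (b ^ 4) ^ 2 ≤ (N ^ m) ^ 2 := by
    calc (b ^ 4) ^ 2 = b ^ 8 := by rw [← pow_mul]
      _ ≤ _ := Nat.pow_le_pow_left hbad 8
      _ = ((2 ^ s) ^ (2 ^ (3 * t + 6) * q)) ^ 8 *
          ((2 * (s + 1) ^ t * 2 ^ (2 * t + 4)) ^ 8) ^ m := by
          rw [mul_pow, pow_right_comm (2 * (s + 1) ^ t * 2 ^ (2 * t + 4))]
      _ ≤ N ^ m * N ^ m := Nat.mul_le_mul h1 (Nat.pow_le_pow_left h2 m)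
      _ = _ := (sq _).symm
  exact (Nat.pow_le_pow_iff_left (by norm_num)).mp h3

/-! ### Distinct rows and existence of a hard matrix -/

/-- Pairing the factors `N - i` and `N - (m - 1 - i)` gives products at least `N`. -/
lemma pow_le_descFactorial_sq {N m : ℕ} (h : m ≤ N) : N ^ m ≤ N.descFactorial m ^ 2 := by
  have hrefl : N.descFactorial m = ∏ i ∈ Finset.range m, (N - (m - 1 - i)) := by
    rw [Nat.descFactorial_eq_prod_range]
    exact (Finset.prod_range_reflect (fun i => N - i) m).symm
  calc N ^ m = ∏ i ∈ Finset.range m, N := by simp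
    _ ≤ ∏ i ∈ Finset.range m, (N - i) * (N - (m - 1 - i)) := by
        refine Finset.prod_le_prod' fun i hi => ?_
        have hi := Finset.mem_range.mp hi
        obtain ⟨a, ha⟩ : ∃ a, N = m + a := ⟨N - m, by omega⟩
        obtain ⟨b, hb⟩ : ∃ b, m = i + 1 + b := ⟨m - 1 - i, by omega⟩
        have e1 : N - i = 1 + b + a := by omega
        have e2 : N - (m - 1 - i) = i + 1 + a := by omega
        rw [e1, e2, ha, hb]
        nlinarith [Nat.zero_le (b * i), Nat.zero_le (a * i), Nat.zero_le (a * b),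
          Nat.zero_le (a * a)]
    _ = N.descFactorial m ^ 2 := by
        rw [Finset.prod_mul_distrib, ← hrefl, ← Nat.descFactorial_eq_prod_range, sq]

lemma card_injective_tuples {α : Type*} [DecidableEq α] {m : ℕ} (S : Finset α) :
    S.card.descFactorial m ≤
      ((Fintype.piFinset fun _ : Fin m => S).filter Function.Injective).card := by
  classical
  have h : Fintype.card (Fin m ↪ S) = S.card.descFactorial m := by
    rw [Fintype.card_embedding_eq]; simp
  rw [← h, ← Finset.card_univ]
  refine Finset.card_le_card_of_injOn (fun e i => (e i : α)) (fun e _ => ?_) fun e _ e' _ hee => ?_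
  · simp only [Finset.coe_filter, Fintype.mem_piFinset, Set.mem_ofPred_eq]
    exact ⟨fun i => (e i).2, Subtype.val_injective.comp e.injective⟩
  · ext i
    exact congrFun hee i

lemma exists_not_hasCellProbeDS {n m s t : ℕ} (S : Finset (Fin n → ZMod 2))
    (ht : 1 ≤ t) (hs : 100 ≤ s) (hm : 1024 * (s * 2 ^ (3 * t)) ≤ m)
    (hS : s ^ (40 * t) ≤ S.card) :
    ∃ M : Matrix (Fin m) (Fin n) (ZMod 2),
      (∀ i, M i ∈ S) ∧ (m ≤ S.card → Function.Injective M) ∧ ¬ HasCellProbeDS M s t := by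
  classical
  by_contra! hcon
  have hm1 : m ≠ 0 := by
    have : 0 < s * 2 ^ (3 * t) := by positivity
    omega
  have hN2 : 2 ≤ S.card := by
    calc 2 ≤ s ^ 1 := by rw [pow_one]; omega
      _ ≤ s ^ (40 * t) := Nat.pow_le_pow_right (by omega) (by omega)
      _ ≤ _ := hS
  have hN : 1 < S.card ^ m := Nat.one_lt_pow hm1 hN2
  -- If all candidates were easy, then `d ^ 4 ≤ |S| ^ m ≤ d ^ 2` with `d > 1`.
  obtain ⟨d, hd, hdb⟩ : ∃ d, S.card ^ m ≤ d ^ 2 ∧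
      d ≤ ((Fintype.piFinset fun _ : Fin m => S).filter fun M =>
        HasCellProbeDS (Matrix.of M) s t).card := by
    by_cases hmS : m ≤ S.card
    · refine ⟨_, pow_le_descFactorial_sq hmS, (card_injective_tuples S).trans
        (Finset.card_le_card fun M hM => ?_)⟩
      rw [Finset.mem_filter, Fintype.mem_piFinset] at hM ⊢
      exact ⟨hM.1, hcon M hM.1 fun _ => hM.2⟩
    · refine ⟨S.card ^ m, Nat.le_self_pow (by norm_num) _, ?_⟩
      rw [← Fintype.card_piFinset_const S m]
      refine Finset.card_le_card fun M hM => ?_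
      rw [Finset.mem_filter]
      exact ⟨hM, hcon M (Fintype.mem_piFinset.mp hM) fun h => absurd h hmS⟩
  have hb := card_hasCellProbeDS_pow_four_le S ht hs hm hS
  have h4 : d ^ 4 ≤ d ^ 2 := (Nat.pow_le_pow_left hdb 4).trans (hb.trans hd)
  have h5 : 1 < d ^ 2 := hN.trans_le hd
  nlinarith

/-! ### Random matrices and the final theorem -/

lemma HasCellProbeDS.mono {m n s t t' : ℕ} {M : Matrix (Fin m) (Fin n) (ZMod 2)}
    (h : HasCellProbeDS M s t) (htt' : t ≤ t') : HasCellProbeDS M s t' := by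
  obtain ⟨pre, alg, halg⟩ := h
  exact ⟨pre, alg, fun i => ⟨(halg i).1.trans htt', (halg i).2⟩⟩

/-- Without probes each answer is constant, and a constant linear form vanishes. This covers `t =
0`, where the general count does not apply. -/
lemma HasCellProbeDS.eq_zero {m n s : ℕ} {M : Matrix (Fin m) (Fin n) (ZMod 2)}
    (h : HasCellProbeDS M s 0) : M = 0 := by
  obtain ⟨pre, alg, halg⟩ := h
  ext i j
  obtain ⟨hd, he⟩ := halg i
  cases hT : alg i with
  | probe c next => simp [hT, ProbeTree.depth] at hd
  | answer b =>
    simp only [hT, ProbeTree.eval] at he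
    have h0 := he 0
    have hj := he (Pi.single j 1)
    simp only [dotProduct_zero, dotProduct_single, mul_one] at h0 hj
    simp [← hj, h0]

lemma ncard_hasCellProbeDS_pow_four_le {n m s t : ℕ} (hs : 100 ≤ s)
    (ht : 1 ≤ t → 1024 * (s * 2 ^ (3 * t)) ≤ m ∧ s ^ (40 * t) ≤ 2 ^ n) :
    {M : Matrix (Fin m) (Fin n) (ZMod 2) | HasCellProbeDS M s t}.ncard ^ 4 ≤ 2 ^ (n * m) := by
  classical
  obtain rfl | ht1 := Nat.eq_zero_or_pos t
  · have h : {M : Matrix (Fin m) (Fin n) (ZMod 2) | HasCellProbeDS M s 0} ⊆ {0} :=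
      fun M hM => HasCellProbeDS.eq_zero hM
    have h1 := Set.ncard_le_ncard h
    rw [Set.ncard_singleton] at h1
    exact (Nat.pow_le_pow_left h1 4).trans (by simpa using Nat.one_le_two_pow)
  · obtain ⟨hm, hn⟩ := ht ht1
    have hcard : (Finset.univ : Finset (Fin n → ZMod 2)).card = 2 ^ n := by simp [ZMod.card]
    have h := card_hasCellProbeDS_pow_four_le (m := m) (Finset.univ : Finset (Fin n → ZMod 2))
      ht1 hs hm (by rwa [hcard])
    rw [hcard, ← pow_mul] at h
    refine (Nat.pow_le_pow_left ?_ 4).trans h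
    rw [← Set.ncard_coe_finset]
    refine Set.ncard_le_ncard_of_injOn Matrix.of.symm (fun M hM => ?_)
      Matrix.of.symm.injective.injOn
    simpa using hM

theorem theorem3p1 :
    -- hard choices of `m` linear functions inside any large enough collection `S`
    (∃ C : ℝ, ∀ (n t s m : ℕ) (S : Finset (Fin n → ZMod 2)),
      100 ≤ t → 100 ≤ s → 100 ≤ m →
      C * ((s : ℝ) * 2 ^ (3 * t)) ≤ (m : ℝ) →
      40 * (t : ℝ) * Real.logb 2 (s : ℝ) ≤ Real.logb 2 (S.card : ℝ) →
      ∃ M : Matrix (Fin m) (Fin n) (ZMod 2),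
        (∀ i, M i ∈ S) ∧ (m ≤ S.card → Function.Injective M) ∧ ¬ HasCellProbeDS M s t) ∧
    -- a uniformly random operator is hard with probability `1 - o(1)` as `s → ∞`
    (∃ c : ℝ, 0 < c ∧ ∀ δ : ℝ, 0 < δ → ∃ K : ℕ, ∀ n m s : ℕ, K ≤ s →
      (1 - δ) * (Nat.card (Matrix (Fin m) (Fin n) (ZMod 2)) : ℝ) ≤
        (Nat.card {M : Matrix (Fin m) (Fin n) (ZMod 2) // ∀ t : ℕ, HasCellProbeDS M s t →
          c * min (Real.logb 2 ((m : ℝ) / (s : ℝ))) ((n : ℝ) / Real.logb 2 (s : ℝ)) ≤ (t : ℝ)} : ℝ)) := by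
  constructor
  · refine ⟨1024, fun n t s m S ht hs _ hm hlog => ?_⟩
    refine exists_not_hasCellProbeDS S (by omega) hs (by exact_mod_cast hm) ?_
    have hs1 : (1 : ℝ) < s := by exact_mod_cast (show 1 < s by omega)
    have hlogs : 0 < Real.logb 2 (s : ℝ) := Real.logb_pos (by norm_num) hs1
    have hSpos : 0 < S.card := by
      rw [Nat.pos_iff_ne_zero]
      intro h0
      rw [h0, Nat.cast_zero, Real.logb_zero] at hlog
      have : (0 : ℝ) < t := by exact_mod_cast (show 0 < t by omega)
      nlinarith [mul_pos this hlogs]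
    have h : Real.logb 2 ((s : ℝ) ^ (40 * t)) ≤ Real.logb 2 (S.card : ℝ) := by
      rw [Real.logb_pow]; push_cast; exact hlog
    rw [Real.logb_le_logb (by norm_num) (by positivity) (by exact_mod_cast hSpos)] at h
    exact_mod_cast h
  · refine ⟨1 / 100, by norm_num, fun δ hδ => ?_⟩
    obtain ⟨K₀, hK₀⟩ := exists_nat_ge (1 / δ ^ 4)
    refine ⟨max 100 K₀, fun n m s hs => ?_⟩
    have hs100 : 100 ≤ s := (le_max_left _ _).trans hs
    have hsK : K₀ ≤ s := (le_max_right _ _).trans hs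
    have hs1 : (1 : ℝ) < s := by exact_mod_cast (show 1 < s by omega)
    have hlogs : 0 < Real.logb 2 (s : ℝ) := Real.logb_pos (by norm_num) hs1
    set R : ℝ := 1 / 100 * min (Real.logb 2 ((m : ℝ) / (s : ℝ)))
      ((n : ℝ) / Real.logb 2 (s : ℝ)) with hR
    set good : Set (Matrix (Fin m) (Fin n) (ZMod 2)) :=
      {M | ∀ t : ℕ, HasCellProbeDS M s t → R ≤ (t : ℝ)} with hgood
    set T : ℝ := (Nat.card (Matrix (Fin m) (Fin n) (ZMod 2)) : ℝ) with hT
    have hTval : T = 2 ^ (n * m) := by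
      rw [hT, Nat.card_eq_fintype_card]
      rw [show Fintype.card (Matrix (Fin m) (Fin n) (ZMod 2)) =
        Fintype.card (Fin m → Fin n → ZMod 2) from Fintype.card_congr Matrix.of.symm]
      simp [ZMod.card, pow_mul]
    have hcompl : (good.ncard : ℝ) + (goodᶜ.ncard : ℝ) = T := by
      rw [hT]; exact_mod_cast Set.ncard_add_ncard_compl good
    suffices hbad : (goodᶜ.ncard : ℝ) ≤ δ * T by
      have : (Nat.card {M : Matrix (Fin m) (Fin n) (ZMod 2) // ∀ t : ℕ, HasCellProbeDS M s t →
          R ≤ (t : ℝ)} : ℝ) = (good.ncard : ℝ) := rfl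
      rw [this]; linarith
    have hTpos : 0 < T := by rw [hTval]; positivity
    -- The case `R ≤ 0` includes all `m ≤ s`.
    obtain hR0 | hR0 := le_or_gt R 0
    · have : goodᶜ = ∅ := by
        rw [Set.compl_empty_iff, Set.eq_univ_iff_forall]
        exact fun M t _ => hR0.trans (Nat.cast_nonneg t)
      rw [this, Set.ncard_empty, Nat.cast_zero]
      positivity
    -- This `t` is the largest integer below `R`; it may be `0`.
    obtain ⟨t, ht⟩ : ∃ t, ⌈R⌉₊ = t + 1 :=
      Nat.exists_eq_add_one_of_ne_zero (Nat.ceil_pos.mpr hR0).ne'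
    have htR : (t : ℝ) < R := by rw [← Nat.lt_ceil]; omega
    have hsub : goodᶜ ⊆ {M | HasCellProbeDS M s t} := by
      intro M hM
      simp only [hgood, Set.mem_compl_iff, Set.mem_ofPred_eq, not_forall, not_le] at hM
      obtain ⟨t', hM, ht'⟩ := hM
      rw [← Nat.lt_ceil] at ht'
      exact hM.mono (by omega)
    have hlm : 100 * (t : ℝ) < Real.logb 2 ((m : ℝ) / s) := by
      have := min_le_left (Real.logb 2 ((m : ℝ) / (s : ℝ))) ((n : ℝ) / Real.logb 2 (s : ℝ))
      linarith
    have hln : 100 * (t : ℝ) * Real.logb 2 s < n := by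
      have := min_le_right (Real.logb 2 ((m : ℝ) / (s : ℝ))) ((n : ℝ) / Real.logb 2 (s : ℝ))
      rw [← lt_div_iff₀ hlogs]
      linarith
    -- For `m = 0` the convention `logb 2 0 = 0` contradicts `R > 0`.
    have hm0 : 0 < m := by
      rw [Nat.pos_iff_ne_zero]
      rintro rfl
      simp only [Nat.cast_zero, zero_div, Real.logb_zero] at hlm
      linarith [Nat.cast_nonneg (α := ℝ) t]
    have hms : s * 2 ^ (100 * t) < m := by
      rw [Real.lt_logb_iff_rpow_lt (by norm_num) (by positivity)] at hlm
      have : (2 : ℝ) ^ (100 * t : ℝ) = 2 ^ (100 * t) := by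
        exact_mod_cast Real.rpow_natCast 2 (100 * t)
      rw [this, lt_div_iff₀ (by linarith), mul_comm] at hlm
      exact_mod_cast hlm
    have hn0 : 0 < n := by
      have : (0 : ℝ) ≤ 100 * (t : ℝ) * Real.logb 2 s := by positivity
      exact_mod_cast this.trans_lt hln
    have hns : s ^ (100 * t) ≤ 2 ^ n := by
      have h : Real.logb 2 ((s : ℝ) ^ (100 * t)) ≤ Real.logb 2 (2 ^ n) := by
        rw [Real.logb_pow, Real.logb_pow]; push_cast; simp; exact hln.le
      rw [Real.logb_le_logb (by norm_num) (by positivity) (by positivity)] at h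
      exact_mod_cast h
    have hcount : (goodᶜ.ncard : ℝ) ^ 4 ≤ T := by
      rw [hTval]
      have h := ncard_hasCellProbeDS_pow_four_le (n := n) (m := m) (t := t) hs100 fun ht1 => by
        constructor
        · calc 1024 * (s * 2 ^ (3 * t)) = s * 2 ^ (10 + 3 * t) := by ring
            _ ≤ s * 2 ^ (100 * t) :=
              Nat.mul_le_mul_left s (Nat.pow_le_pow_right (by norm_num) (by omega))
            _ ≤ m := hms.le
        · exact (Nat.pow_le_pow_right (by omega) (by omega)).trans hns
      exact_mod_cast (Nat.pow_le_pow_left (Set.ncard_le_ncard hsub) 4).trans h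
    -- At most `T ^ (1 / 4)` matrices are bad, so `T ≥ s ≥ 1 / δ ^ 4` is more than enough for `δ *
    -- T`.
    have hTs : 1 / δ ^ 4 ≤ T := by
      have h1 : s ≤ n * m := by
        calc s ≤ s * 2 ^ (100 * t) := Nat.le_mul_of_pos_right s (by positivity)
          _ ≤ m := hms.le
          _ ≤ n * m := Nat.le_mul_of_pos_left m hn0
      calc 1 / δ ^ 4 ≤ K₀ := hK₀
        _ ≤ ((n * m : ℕ) : ℝ) := by exact_mod_cast hsK.trans h1
        _ ≤ T := by rw [hTval]; exact_mod_cast (Nat.lt_two_pow_self).le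
    have hT1 : 1 ≤ T := by rw [hTval]; exact one_le_pow₀ (by norm_num)
    rw [div_le_iff₀ (by positivity)] at hTs
    refine le_of_pow_le_pow_left₀ (n := 4) (by norm_num) (by positivity) (hcount.trans ?_)
    calc T ≤ T * (T * δ ^ 4) := le_mul_of_one_le_right hTpos.le hTs
      _ = δ ^ 4 * T ^ 2 := by ring
      _ ≤ δ ^ 4 * T ^ 4 := by gcongr; norm_num
      _ = (δ * T) ^ 4 := by ring
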